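/- Let $1<p<\infty$ and let $V,W:(0,\infty)\to[0,\infty]$ be Lebesgue measurable functions that are finite almost everywhere, such that $$\int_0^s V(t)^{-\frac1{p-1}}\,dt<\infty\qquad\text{for all } s\in(0,\infty).$$ Set $$\overline B:=\sup_{s>0}\left(\int_0^s V(t)^{-\frac1{p-1}}\,dt\right)^{p-1}\int_s^\infty W(t)\,dt$$ and $$\underline B:=\sup_{s>0}\left(\int_0^s V(t)^{-\frac1{p-1}}\,dt\right)^{-1}\int_0^s W(t)\left(\int_0^t V(t')^{-\frac1{p-1}}\,dt'\right)^p dt.$$ Then for every (real- or complex-valued) function $u$ on $(0,\infty)$ that is locally absolutely continuous, that is, absolutely continuous on every compact subinterval of $(0,\infty)$, and satisfies $\liminf_{r\to0}|u(r)|=0$, one has $$\int_0^\infty W(r)|u(r)|^p\,dr\le\frac{p^p}{(p-1)^{p-1}}\,\overline B\int_0^\infty V(r)|u'(r)|^p\,dr$$ and $$\int_0^\infty W(r)|u(r)|^p\,dr\le\left(\frac{p}{p-1}\right)^p\underline B\int_0^\infty V(r)|u'(r)|^p\,dr.$$ Here all integrals and suprema take values in $[0,\infty]$, with the conventions $0\cdot\infty=0$,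 $0^{-1/(p-1)}=\infty$ and $\infty^{-1/(p-1)}=0$. -/

import Mathlib

open Set Filter MeasureTheory
open scoped Topology ENNReal

/-- `u` is locally absolutely continuous on `(0, ∞)`: it is absolutely continuous on every
compact interval `[a, b] ⊂ (0, ∞)`. The values of `u` outside `(0, ∞)` play no role. -/
def LocallyACOnPos {E : Type*} [NormedAddCommGroup E] (u : ℝ → E) : Prop :=
  ∀ a b : ℝ, 0 < a → a ≤ b → AbsolutelyContinuousOnInterval u a b

/-- The primitive `φ(s) = ∫₀ˢ V(t)^(-1/(p-1)) dt`, with values in `[0, ∞]`. -/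
noncomputable def hardyPhi (p : ℝ) (V : ℝ → ℝ≥0∞) (s : ℝ) : ℝ≥0∞ :=
  ∫⁻ t in Ioo 0 s, V t ^ (-(1 / (p - 1)))

/-- `B̄ = sup_{s>0} (∫₀ˢ V^(-1/(p-1)))^(p-1) ∫ₛ^∞ W`. -/
noncomputable def hardyBUpper (p : ℝ) (V W : ℝ → ℝ≥0∞) : ℝ≥0∞ :=
  ⨆ (s : ℝ) (_ : 0 < s), hardyPhi p V s ^ (p - 1) * ∫⁻ t in Ioi s, W t

/-- `B̲ = sup_{s>0} (∫₀ˢ V^(-1/(p-1)))^(-1) ∫₀ˢ W(t) (∫₀ᵗ V^(-1/(p-1)))^p dt`. -/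
noncomputable def hardyBLower (p : ℝ) (V W : ℝ → ℝ≥0∞) : ℝ≥0∞ :=
  ⨆ (s : ℝ) (_ : 0 < s),
    (hardyPhi p V s)⁻¹ * ∫⁻ t in Ioo 0 s, W t * hardyPhi p V t ^ p

/-! ### Absolutely continuous functions vanishing at the origin -/

/-! With `v = V^(-1/(p-1))`, `dμ = v dt`, `dν = W dt` on the half-line and `f = |u'|/v`, one has
`|u(r)| ≤ ∫_{t<r} f dμ` and `∫ f^p dμ = ∫ V|u'|^p`. Both claims thus become Hardy inequalities for a
pair of atomless measures. Write `φ(t) = μ(Iio t)`. For the tail constant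
(`lintegral_hardy_le_of_tail_bound`), Hölder with a power of `φ` as weight, followed by Tonelli,
leaves integrals of negative powers of `φ` and of the tail of `ν`. `lintegral_rpow_neg_le` bounds
both. For the averaged constant (`lintegral_hardy_le_of_average_bound`), `∫_{t<r} f dμ = φ U` with
`U` the running average of `f`. Replace `U` by a decreasing majorant: on decreasing functions the
hypothesis lets `B μ` dominate `φ^p ν`, and Doob's maximal inequality bounds the majorant in
`L^p(μ)`. -/

theorem AbsolutelyContinuousOnInterval.norm {E : Type*} [NormedAddCommGroup E] {u : ℝ → E}
    {a b : ℝ} (hu : AbsolutelyContinuousOnInterval u a b) :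
    AbsolutelyContinuousOnInterval (fun x => ‖u x‖) a b := by
  rw [absolutelyContinuousOnInterval_iff] at hu ⊢
  intro ε hε
  obtain ⟨δ, hδ, h⟩ := hu ε hε
  refine ⟨δ, hδ, fun I hI hIδ => lt_of_le_of_lt (Finset.sum_le_sum fun i _ => ?_) (h I hI hIδ)⟩
  rw [Real.dist_eq, dist_eq_norm]
  exact abs_norm_sub_norm_le _ _

theorem abs_deriv_norm_le_norm_deriv {E : Type*} [NormedAddCommGroup E] [NormedSpace ℝ E]
    {u : ℝ → E} {x : ℝ} (hu : DifferentiableAt ℝ u x)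
    (hn : DifferentiableAt ℝ (fun y => ‖u y‖) x) :
    |deriv (fun y => ‖u y‖) x| ≤ ‖deriv u x‖ := by
  have h1 := (hasDerivAt_iff_tendsto_slope.1 hn.hasDerivAt).abs
  have h2 := (hasDerivAt_iff_tendsto_slope.1 hu.hasDerivAt).norm
  refine le_of_tendsto_of_tendsto' h1 h2 fun y => ?_
  simp only [slope_def_module, smul_eq_mul, abs_mul, norm_smul, Real.norm_eq_abs]
  exact mul_le_mul_of_nonneg_left (abs_norm_sub_norm_le _ _) (abs_nonneg _)

/-- Passing to `‖u‖` leaves only the fundamental theorem of calculus for a real function. -/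
theorem AbsolutelyContinuousOnInterval.enorm_le_add_lintegral {E : Type*} [NormedAddCommGroup E]
    [NormedSpace ℝ E] [FiniteDimensional ℝ E] {u : ℝ → E} {a b : ℝ} (hab : a ≤ b)
    (hu : AbsolutelyContinuousOnInterval u a b) :
    ‖u b‖ₑ ≤ ‖u a‖ₑ + ∫⁻ t in Ioc a b, ‖deriv u t‖ₑ := by
  have hftc := hu.norm.integral_deriv_eq_sub
  have hle : ‖∫ x in a..b, deriv (fun y => ‖u y‖) x‖ₑ ≤ ∫⁻ t in Ioc a b, ‖deriv u t‖ₑ := by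
    rw [intervalIntegral.integral_of_le hab]
    refine (enorm_integral_le_lintegral_enorm _).trans (lintegral_mono_ae ?_)
    rw [ae_restrict_iff' measurableSet_Ioc]
    filter_upwards [hu.boundedVariationOn.ae_differentiableAt_of_mem_uIcc,
      hu.norm.boundedVariationOn.ae_differentiableAt_of_mem_uIcc] with x h1 h2 hx
    have hx' : x ∈ uIcc a b := by rw [uIcc_of_le hab]; exact Ioc_subset_Icc_self hx
    rw [enorm_le_iff_norm_le]
    exact abs_deriv_norm_le_norm_deriv (h1 hx') (h2 hx')
  rw [hftc] at hle
  calc ‖u b‖ₑ = ‖(‖u a‖ + (‖u b‖ - ‖u a‖) : ℝ)‖ₑ := by rw [add_sub_cancel, enorm_norm]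
    _ ≤ ‖(‖u a‖ : ℝ)‖ₑ + ‖(‖u b‖ - ‖u a‖ : ℝ)‖ₑ := enorm_add_le _ _
    _ ≤ _ := by rw [enorm_norm]; gcongr

theorem LocallyACOnPos.enorm_le_lintegral {E : Type*} [NormedAddCommGroup E]
    [NormedSpace ℝ E] [FiniteDimensional ℝ E] {u : ℝ → E} (hu : LocallyACOnPos u)
    (hu0 : liminf (fun r : ℝ => ‖u r‖ₑ) (𝓝[>] 0) = 0) {r : ℝ} (hr : 0 < r) :
    ‖u r‖ₑ ≤ ∫⁻ t in Ioo 0 r, ‖deriv u t‖ₑ := by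
  refine le_of_forall_gt_imp_ge_of_dense fun c hc => ?_
  obtain ⟨d, hd, hdc⟩ : ∃ d, 0 < d ∧ (∫⁻ t in Ioo 0 r, ‖deriv u t‖ₑ) + d ≤ c :=
    ⟨c - _, tsub_pos_of_lt hc, (add_tsub_cancel_of_le hc.le).le⟩
  -- A zero liminf only gives small values of `u` at points arbitrarily near the origin; that
  -- suffices.
  have hfreq : ∃ᶠ a in 𝓝[>] (0 : ℝ), ‖u a‖ₑ < d :=
    frequently_lt_of_liminf_lt (by isBoundedDefault) (hu0 ▸ hd)
  obtain ⟨a, had, ha0, har⟩ := (hfreq.and_eventually (Ioo_mem_nhdsGT hr)).exists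
  calc ‖u r‖ₑ ≤ ‖u a‖ₑ + ∫⁻ t in Ioc a r, ‖deriv u t‖ₑ :=
        (hu a r ha0 har.le).enorm_le_add_lintegral har.le
    _ = ‖u a‖ₑ + ∫⁻ t in Ioo a r, ‖deriv u t‖ₑ := by
        rw [restrict_Ioo_eq_restrict_Ioc]
    _ ≤ d + ∫⁻ t in Ioo 0 r, ‖deriv u t‖ₑ := by
        gcongr
    _ ≤ c := by rwa [add_comm]

/-! ### Measures of lower and upper sets of the line -/

/-- By Lindelöf the union reduces to a countable chain, where the measure is continuous from below;
the leftover point is null. -/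
theorem measure_le_iSup_of_directedOn_isOpen {m : Measure ℝ} [NullSingletonClass m] {S : Set ℝ}
    {J : ℝ → Set ℝ} (hJ : ∀ i, IsOpen (J i)) (hdir : ∀ i j, J i ⊆ J j ∨ J j ⊆ J i)
    (hS : (S \ ⋃ i ∈ S, J i).Subsingleton) : m S ≤ ⨆ i ∈ S, m (J i) := by
  obtain ⟨T, hTS, hT, hU⟩ := TopologicalSpace.isOpen_biUnion_countable S J fun i _ => hJ i
  have hd : DirectedOn (Function.onFun (· ⊆ ·) J) T := fun i hi j hj =>
    (hdir i j).elim (fun h => ⟨j, hj, h, Subset.rfl⟩) fun h => ⟨i, hi, Subset.rfl, h⟩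
  calc m S ≤ m ((S \ ⋃ i ∈ S, J i) ∪ ⋃ i ∈ S, J i) := measure_mono (by simp)
    _ ≤ m (S \ ⋃ i ∈ S, J i) + m (⋃ i ∈ S, J i) := measure_union_le _ _
    _ = ⨆ i ∈ T, m (J i) := by
        rw [hS.measure_zero, zero_add, ← hU, measure_biUnion_eq_iSup hT hd]
    _ ≤ ⨆ i ∈ S, m (J i) := biSup_mono hTS

theorem measure_le_iSup_Iio (m : Measure ℝ) [NullSingletonClass m] (S : Set ℝ) :
    m S ≤ ⨆ s ∈ S, m (Iio s) := by
  refine measure_le_iSup_of_directedOn_isOpen (fun _ => isOpen_Iio)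
    (fun i j => (le_total i j).imp Iio_subset_Iio Iio_subset_Iio) ?_
  rintro x ⟨hx, hx'⟩ y ⟨hy, hy'⟩
  simp only [mem_iUnion, mem_Iio, not_exists, not_lt] at hx' hy'
  exact le_antisymm (hy' x hx) (hx' y hy)

theorem measure_le_iSup_Ioi (m : Measure ℝ) [NullSingletonClass m] (S : Set ℝ) :
    m S ≤ ⨆ s ∈ S, m (Ioi s) := by
  refine measure_le_iSup_of_directedOn_isOpen (fun _ => isOpen_Ioi)
    (fun i j => (le_total i j).symm.imp Ioi_subset_Ioi Ioi_subset_Ioi) ?_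
  rintro x ⟨hx, hx'⟩ y ⟨hy, hy'⟩
  simp only [mem_iUnion, mem_Ioi, not_exists, not_lt] at hx' hy'
  exact le_antisymm (hx' y hy) (hy' x hx)

theorem measure_setOf_measure_Iio_le (m : Measure ℝ) [NullSingletonClass m] (x : ℝ≥0∞) :
    m {t | m (Iio t) ≤ x} ≤ x :=
  (measure_le_iSup_Iio m _).trans (iSup₂_le fun _ h => h)

theorem measure_setOf_measure_Ioi_le (m : Measure ℝ) [NullSingletonClass m] (x : ℝ≥0∞) :
    m {t | m (Ioi t) ≤ x} ≤ x :=
  (measure_le_iSup_Ioi m _).trans (iSup₂_le fun _ h => h)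

theorem measurable_measure_Iio (m : Measure ℝ) : Measurable fun t => m (Iio t) :=
  Monotone.measurable fun _ _ h => measure_mono (Iio_subset_Iio h)

theorem measurable_measure_Ioi (m : Measure ℝ) : Measurable fun t => m (Ioi t) :=
  Antitone.measurable fun _ _ h => measure_mono (Ioi_subset_Ioi h)

/-! ### Integrating a negative power of a distribution function -/

theorem lintegral_min_rpow_le {A b : ℝ} (hA : 0 < A) (hb0 : 0 < b) (hb1 : b < 1) :
    ∫⁻ t in Ioi (0 : ℝ), min (ENNReal.ofReal A) (ENNReal.ofReal (t ^ (-(1 / b)))) ≤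
      ENNReal.ofReal (A ^ (1 - b) / (1 - b)) := by
  -- `A ^ (-b)` is where the two terms of the minimum cross.
  have ht0 : 0 < A ^ (-b) := Real.rpow_pos_of_pos hA _
  have hlt : -(1 / b) < -1 := by
    rw [neg_lt_neg_iff, one_lt_div hb0]; exact hb1
  rw [← Ioc_union_Ioi_eq_Ioi ht0.le]
  refine (lintegral_union_le _ _ _).trans ?_
  calc _ ≤ (∫⁻ _ in Ioc 0 (A ^ (-b)), ENNReal.ofReal A) +
        ∫⁻ t in Ioi (A ^ (-b)), ENNReal.ofReal (t ^ (-(1 / b))) := by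
        gcongr
        · exact min_le_left _ _
        · exact min_le_right _ _
    _ = ENNReal.ofReal (A * A ^ (-b)) +
        ENNReal.ofReal (-(A ^ (-b)) ^ (-(1 / b) + 1) / (-(1 / b) + 1)) := by
        rw [setLIntegral_const, Real.volume_Ioc, sub_zero, ← ENNReal.ofReal_mul hA.le,
          ← integral_Ioi_rpow_of_lt hlt ht0, ofReal_integral_eq_lintegral_ofReal
            (integrableOn_Ioi_rpow_of_lt hlt ht0)]
        rw [EventuallyLE, ae_restrict_iff' measurableSet_Ioi]
        exact ae_of_all _ fun t ht => Real.rpow_nonneg (ht0.trans ht).le _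
    _ = ENNReal.ofReal (A ^ (1 - b) / (1 - b)) := by
        have hpow : (A ^ (-b)) ^ (-(1 / b) + 1) = A ^ (1 - b) := by
          rw [← Real.rpow_mul hA.le]; congr 1; field_simp; ring
        have hpow' : A * A ^ (-b) = A ^ (1 - b) := by
          rw [sub_eq_add_neg, Real.rpow_add hA, Real.rpow_one]
        have hA' := Real.rpow_pos_of_pos hA (1 - b)
        have h1b : 0 < 1 - b := sub_pos.2 hb1
        have hden : -(1 / b) + 1 = -((1 - b) / b) := by field_simp; ring
        rw [hpow, hpow', hden, neg_div_neg_eq, ← ENNReal.ofReal_add hA'.le (by positivity)]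
        congr 1
        field_simp
        ring

/-- This replaces the substitution `x = F t`: by layer cake, the worst case is `F` uniformly
distributed on `[0, m univ]`, giving `∫ x^(-b) dx`. -/
theorem lintegral_rpow_neg_le {α : Type*} [MeasurableSpace α] {m : Measure α} {F : α → ℝ≥0∞}
    (hF : Measurable F) (hm : ∀ x, m {t | F t ≤ x} ≤ x) {b : ℝ} (hb0 : 0 < b) (hb1 : b < 1) :
    ∫⁻ t, F t ^ (-b) ∂m ≤ ENNReal.ofReal (1 / (1 - b)) * m univ ^ (1 - b) := by
  have h1b : 0 < 1 - b := sub_pos.2 hb1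
  rcases eq_or_ne (m univ) ∞ with htop | htop
  · rw [htop, ENNReal.top_rpow_of_pos h1b, ENNReal.mul_top]
    · exact le_top
    · simpa using hb1
  rcases eq_or_ne (m univ) 0 with hzero | hzero
  · simp [Measure.measure_univ_eq_zero.1 hzero]
  have hA : 0 < (m univ).toReal := ENNReal.toReal_pos hzero htop
  have hF0 : ∀ᵐ t ∂m, F t ≠ 0 := by
    refine measure_mono_null (fun t ht => ?_) (le_zero_iff.1 (hm 0))
    simpa using ht
  have hcongr : ∫⁻ t, F t ^ (-b) ∂m = ∫⁻ t, ENNReal.ofReal ((F t ^ (-b)).toReal) ∂m := by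
    refine lintegral_congr_ae ?_
    filter_upwards [hF0] with t ht
    rw [ENNReal.ofReal_toReal]
    simp [ENNReal.rpow_eq_top_iff, ht, hb0.le]
  rw [hcongr, lintegral_eq_lintegral_meas_lt m (ae_of_all _ fun _ => ENNReal.toReal_nonneg)
    (hF.pow_const _).ennreal_toReal.aemeasurable]
  calc _ ≤ ∫⁻ t in Ioi (0 : ℝ),
        min (ENNReal.ofReal (m univ).toReal) (ENNReal.ofReal (t ^ (-(1 / b)))) := by
        refine setLIntegral_mono' measurableSet_Ioi fun t ht => le_min ?_ ?_
        · rw [ENNReal.ofReal_toReal htop]; exact measure_mono (subset_univ _)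
        · refine (measure_mono fun a ha => ?_).trans (hm _)
          have ht0 : (0 : ℝ) < t := ht
          have h1 : ENNReal.ofReal t ≤ F a ^ (-b) :=
            ENNReal.ofReal_le_of_le_toReal (le_of_lt ha)
          rw [mem_ofPred_eq, ← ENNReal.ofReal_rpow_of_pos ht0, ENNReal.rpow_neg,
            ENNReal.le_inv_iff_le_inv]
          calc ENNReal.ofReal t ^ (1 / b) ≤ (F a ^ (-b)) ^ (1 / b) := by gcongr
            _ = (F a)⁻¹ := by
              rw [← ENNReal.rpow_mul, ← ENNReal.rpow_neg_one]
              congr 1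
              field_simp
    _ ≤ ENNReal.ofReal ((m univ).toReal ^ (1 - b) / (1 - b)) := lintegral_min_rpow_le hA hb0 hb1
    _ = ENNReal.ofReal (1 / (1 - b)) * m univ ^ (1 - b) := by
        rw [div_eq_mul_one_div, mul_comm, ENNReal.ofReal_mul (by positivity),
          ← ENNReal.ofReal_rpow_of_pos hA, ENNReal.ofReal_toReal htop]

/-! ### Muckenhoupt's inequality for pairs of measures -/

theorem lintegral_Iio_rpow_le {p : ℝ} (hp : 1 < p) {μ : Measure ℝ} [NullSingletonClass μ]
    (hμ : ∀ s, μ (Iio s) ≠ ∞) {f : ℝ → ℝ≥0∞} (hf : Measurable f) (r : ℝ) :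
    (∫⁻ t in Iio r, f t ∂μ) ^ p ≤
      (∫⁻ t in Iio r, f t ^ p * μ (Iio t) ^ ((p - 1) / p) ∂μ) *
        (ENNReal.ofReal (p / (p - 1)) ^ (p - 1) * (μ (Iio r) ^ (p - 1)) ^ ((p - 1) / p)) := by
  have hp0 : 0 < p := one_pos.trans hp
  have hp1 : 0 < p - 1 := sub_pos.2 hp
  have hpq : p.HolderConjugate (p / (p - 1)) := Real.HolderConjugate.conjExponent hp
  have hφ := measurable_measure_Iio μ
  -- Then `a * p = (p - 1) / p`, while the dual factor carries `φ ^ (-1/p)`, an integrable power.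
  set a : ℝ := (p - 1) / p / p with ha
  have hfac : ∫⁻ t in Iio r, f t ∂μ =
      ∫⁻ t in Iio r, ((fun t => f t * μ (Iio t) ^ a) * fun t => μ (Iio t) ^ (-a)) t ∂μ := by
    refine lintegral_congr_ae (ae_restrict_of_ae ?_)
    have h0 : ∀ᵐ t ∂μ, μ (Iio t) ≠ 0 := by
      refine measure_mono_null (fun t ht => ?_) (le_zero_iff.1 (measure_setOf_measure_Iio_le μ 0))
      simpa using ht
    filter_upwards [h0] with t ht
    rw [Pi.mul_apply, mul_assoc, ← ENNReal.rpow_add _ _ ht (hμ t), add_neg_cancel,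
      ENNReal.rpow_zero, mul_one]
  have hY : ∫⁻ t in Iio r, (μ (Iio t) ^ (-a)) ^ (p / (p - 1)) ∂μ ≤
      ENNReal.ofReal (p / (p - 1)) * μ (Iio r) ^ ((p - 1) / p) := by
    have h := lintegral_rpow_neg_le (m := μ.restrict (Iio r)) hφ
      (fun x => (Measure.restrict_apply_le _ _).trans (measure_setOf_measure_Iio_le μ x))
      (b := 1 / p) (by positivity) (by rwa [div_lt_one hp0])
    have e1 : 1 - 1 / p = (p - 1) / p := by field_simp
    rw [e1, one_div_div, Measure.restrict_apply_univ] at h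
    refine le_trans (le_of_eq ?_) h
    refine lintegral_congr fun t => ?_
    rw [← ENNReal.rpow_mul]
    congr 1
    rw [ha]; field_simp
  have hX : ∫⁻ t in Iio r, (f t * μ (Iio t) ^ a) ^ p ∂μ =
      ∫⁻ t in Iio r, f t ^ p * μ (Iio t) ^ ((p - 1) / p) ∂μ := by
    refine lintegral_congr fun t => ?_
    rw [ENNReal.mul_rpow_of_nonneg _ _ hp0.le, ← ENNReal.rpow_mul, ha,
      div_mul_cancel₀ _ hp0.ne']
  have hH := ENNReal.lintegral_mul_le_Lp_mul_Lq (μ.restrict (Iio r)) hpq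
    (f := fun t => f t * μ (Iio t) ^ a) (g := fun t => μ (Iio t) ^ (-a))
    (hf.mul (hφ.pow_const _)).aemeasurable (hφ.pow_const _).aemeasurable
  rw [← hfac, hX] at hH
  calc _ ≤ _ := ENNReal.rpow_le_rpow hH hp0.le
    _ ≤ ((∫⁻ t in Iio r, f t ^ p * μ (Iio t) ^ ((p - 1) / p) ∂μ) ^ (1 / p) *
        (ENNReal.ofReal (p / (p - 1)) * μ (Iio r) ^ ((p - 1) / p)) ^ (1 / (p / (p - 1)))) ^ p := by
        gcongr
    _ = _ := by
        rw [ENNReal.mul_rpow_of_nonneg _ _ hp0.le, ← ENNReal.rpow_mul, ← ENNReal.rpow_mul,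
          one_div_mul_cancel hp0.ne', ENNReal.rpow_one]
        have e2 : 1 / (p / (p - 1)) * p = p - 1 := by field_simp
        rw [e2, ENNReal.mul_rpow_of_nonneg _ _ hp1.le, ← ENNReal.rpow_mul, ← ENNReal.rpow_mul,
          mul_comm (p - 1)]

/-- `hB` enters twice: at `r`, to trade `φ r` for a negative power of the tail of `ν`, and at `t`,
to absorb what remains. The powers of `B` add up to one. -/
theorem rpow_mul_lintegral_Ioi_rpow_le {p : ℝ} (hp : 1 < p) {φ : ℝ → ℝ≥0∞} {ν : Measure ℝ}
    [NullSingletonClass ν] {B : ℝ≥0∞} (hB0 : B ≠ 0) (hBtop : B ≠ ∞)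
    (hB : ∀ s, φ s ^ (p - 1) * ν (Ioi s) ≤ B) (t : ℝ) :
    φ t ^ ((p - 1) / p) * ∫⁻ r in Ioi t, (φ r ^ (p - 1)) ^ ((p - 1) / p) ∂ν ≤
      ENNReal.ofReal p * B := by
  have hp0 : 0 < p := one_pos.trans hp
  have hp1 : 0 < p - 1 := sub_pos.2 hp
  have hg : 0 < (p - 1) / p := by positivity
  have hle : ∀ r, (φ r ^ (p - 1)) ^ ((p - 1) / p) ≤
      B ^ ((p - 1) / p) * ν (Ioi r) ^ (-((p - 1) / p)) := fun r => by
    rw [ENNReal.rpow_neg, ← ENNReal.inv_rpow, ← ENNReal.mul_rpow_of_nonneg _ _ hg.le,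
      ← div_eq_mul_inv]
    refine ENNReal.rpow_le_rpow ?_ hg.le
    rw [ENNReal.le_div_iff_mul_le (Or.inr hB0) (Or.inr hBtop)]
    exact hB r
  have hψ := lintegral_rpow_neg_le (m := ν.restrict (Ioi t)) (measurable_measure_Ioi ν)
    (fun x => (Measure.restrict_apply_le _ _).trans (measure_setOf_measure_Ioi_le ν x)) hg
    (by rw [div_lt_one hp0]; linarith)
  have e1 : 1 - (p - 1) / p = 1 / p := by field_simp; ring
  rw [e1, one_div_one_div, Measure.restrict_apply_univ] at hψ
  calc _ ≤ φ t ^ ((p - 1) / p) *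
        ∫⁻ r in Ioi t, B ^ ((p - 1) / p) * ν (Ioi r) ^ (-((p - 1) / p)) ∂ν := by
        gcongr with r
        exact hle r
    _ = φ t ^ ((p - 1) / p) * (B ^ ((p - 1) / p) *
        ∫⁻ r in Ioi t, ν (Ioi r) ^ (-((p - 1) / p)) ∂ν) := by
        rw [lintegral_const_mul _ ((measurable_measure_Ioi ν).pow_const _)]
    _ ≤ φ t ^ ((p - 1) / p) * (B ^ ((p - 1) / p) * (ENNReal.ofReal p * ν (Ioi t) ^ (1 / p))) := by
        gcongr
    _ = ENNReal.ofReal p * (B ^ ((p - 1) / p) * (φ t ^ (p - 1) * ν (Ioi t)) ^ (1 / p)) := by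
        rw [ENNReal.mul_rpow_of_nonneg _ _ (by positivity : 0 ≤ 1 / p), ← ENNReal.rpow_mul,
          mul_one_div]
        ring
    _ ≤ ENNReal.ofReal p * (B ^ ((p - 1) / p) * B ^ (1 / p)) := by
        gcongr
        exact hB t
    _ = ENNReal.ofReal p * B := by
        rw [← ENNReal.rpow_add _ _ hB0 hBtop, ← e1, add_sub_cancel, ENNReal.rpow_one]

theorem lintegral_lintegral_Iio_mul {μ ν : Measure ℝ} [SFinite μ] [SFinite ν]
    {G H : ℝ → ℝ≥0∞} (hG : Measurable G) (hH : Measurable H) :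
    ∫⁻ r, (∫⁻ t in Iio r, G t ∂μ) * H r ∂ν = ∫⁻ t, G t * ∫⁻ r in Ioi t, H r ∂ν ∂μ := by
  have hmeas : Measurable (Function.uncurry fun r t : ℝ => (Iio r).indicator G t * H r) := by
    have : (Function.uncurry fun r t : ℝ => (Iio r).indicator G t * H r) =
        fun z => {z : ℝ × ℝ | z.2 < z.1}.indicator (fun z => G z.2) z * H z.1 := by
      ext ⟨r, t⟩
      simp [indicator]
    rw [this]
    exact ((hG.comp measurable_snd).indicator (measurableSet_lt measurable_snd measurable_fst)).mul
      (hH.comp measurable_fst)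
  calc _ = ∫⁻ r, ∫⁻ t, (Iio r).indicator G t * H r ∂μ ∂ν := by
        refine lintegral_congr fun r => ?_
        rw [lintegral_mul_const _ (hG.indicator measurableSet_Iio),
          lintegral_indicator measurableSet_Iio]
    _ = ∫⁻ t, ∫⁻ r, (Iio r).indicator G t * H r ∂ν ∂μ :=
        lintegral_lintegral_swap hmeas.aemeasurable
    _ = _ := by
        refine lintegral_congr fun t => ?_
        rw [← lintegral_const_mul _ hH, ← lintegral_indicator measurableSet_Ioi]
        refine lintegral_congr fun r => ?_
        by_cases h : t < r <;> simp [h]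

theorem lintegral_hardy_le_of_tail_bound {p : ℝ} (hp : 1 < p) {μ ν : Measure ℝ}
    [SFinite μ] [SFinite ν] [NullSingletonClass μ] [NullSingletonClass ν]
    (hμ : ∀ s, μ (Iio s) ≠ ∞) {f : ℝ → ℝ≥0∞} (hf : Measurable f) {B : ℝ≥0∞}
    (hB : ∀ s, μ (Iio s) ^ (p - 1) * ν (Ioi s) ≤ B) :
    ∫⁻ r, (∫⁻ t in Iio r, f t ∂μ) ^ p ∂ν ≤
      ENNReal.ofReal (p ^ p / (p - 1) ^ (p - 1)) * B * ∫⁻ t, f t ^ p ∂μ := by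
  have hp0 : 0 < p := one_pos.trans hp
  have hp1 : 0 < p - 1 := sub_pos.2 hp
  have hC : 0 < p ^ p / (p - 1) ^ (p - 1) := by positivity
  -- Degenerate cases, where division by `B` or the convention `0 * ∞ = 0` intervenes.
  rcases eq_or_ne B 0 with rfl | hB0
  · have hnull : ∀ᵐ r ∂ν, ν (Ioi r) ≠ 0 := by
      refine measure_mono_null (fun t ht => ?_) (le_zero_iff.1 (measure_setOf_measure_Ioi_le ν 0))
      simpa using ht
    have hzero : ∫⁻ r, (∫⁻ t in Iio r, f t ∂μ) ^ p ∂ν = 0 := by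
      rw [← lintegral_zero (μ := ν)]
      refine lintegral_congr_ae ?_
      filter_upwards [hnull] with r hr
      have h0 : μ (Iio r) = 0 := by
        have := (mul_eq_zero.1 (le_zero_iff.1 (hB r))).resolve_right hr
        exact (ENNReal.rpow_eq_zero_iff_of_pos hp1).1 this
      rw [Measure.restrict_eq_zero.2 h0, lintegral_zero_measure, ENNReal.zero_rpow_of_pos hp0]
    simp [hzero]
  rcases eq_or_ne (∫⁻ t, f t ^ p ∂μ) 0 with hf0 | hf0
  · have hfae : f =ᵐ[μ] 0 := by
      rw [lintegral_eq_zero_iff (hf.pow_const _)] at hf0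
      filter_upwards [hf0] with t ht
      exact (ENNReal.rpow_eq_zero_iff_of_pos hp0).1 ht
    have hzero : ∀ r, ∫⁻ t in Iio r, f t ∂μ = 0 := fun r => by
      rw [lintegral_congr_ae (ae_restrict_of_ae hfae)]; simp
    simp [hzero, ENNReal.zero_rpow_of_pos hp0]
  rcases eq_or_ne B ∞ with rfl | hBtop
  · rw [ENNReal.mul_top (by simpa using hC), ENNReal.top_mul hf0]
    exact le_top
  have hφ := measurable_measure_Iio μ
  calc _ ≤ ∫⁻ r, (∫⁻ t in Iio r, f t ^ p * μ (Iio t) ^ ((p - 1) / p) ∂μ) *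
        (ENNReal.ofReal (p / (p - 1)) ^ (p - 1) * (μ (Iio r) ^ (p - 1)) ^ ((p - 1) / p)) ∂ν :=
        lintegral_mono fun r => lintegral_Iio_rpow_le hp hμ hf r
    _ = ENNReal.ofReal (p / (p - 1)) ^ (p - 1) * ∫⁻ t, f t ^ p * (μ (Iio t) ^ ((p - 1) / p) *
        ∫⁻ r in Ioi t, (μ (Iio r) ^ (p - 1)) ^ ((p - 1) / p) ∂ν) ∂μ := by
        rw [lintegral_lintegral_Iio_mul ((hf.pow_const _).fun_mul (hφ.pow_const _))
          (((hφ.pow_const _).pow_const _).const_mul _), ← lintegral_const_mul']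
        · refine lintegral_congr fun t => ?_
          rw [lintegral_const_mul _ ((hφ.pow_const _).pow_const _)]
          ring
        · exact ENNReal.rpow_ne_top_of_nonneg hp1.le ENNReal.ofReal_ne_top
    _ ≤ ENNReal.ofReal (p / (p - 1)) ^ (p - 1) * ∫⁻ t, f t ^ p * (ENNReal.ofReal p * B) ∂μ := by
        gcongr _ * ∫⁻ t, f t ^ p * ?_ ∂μ with t
        exact rpow_mul_lintegral_Ioi_rpow_le hp hB0 hBtop hB t
    _ = ENNReal.ofReal (p / (p - 1)) ^ (p - 1) * ENNReal.ofReal p * B * ∫⁻ t, f t ^ p ∂μ := by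
        rw [lintegral_mul_const _ (hf.pow_const _)]
        ring
    _ = _ := by
        rw [ENNReal.ofReal_rpow_of_pos (by positivity), ← ENNReal.ofReal_mul (by positivity),
          Real.div_rpow hp0.le hp1.le, div_mul_eq_mul_div, ← Real.rpow_add_one hp0.ne',
          sub_add_cancel]

/-! ### Doob's maximal inequality -/

/-- Layer cake for `m ^ p` under `μ` and for `m ^ (p - 1)` under `f μ`, linked by the weak-type
bound, then Hölder. Finiteness permits dividing by a power of `A`. -/
theorem lintegral_rpow_le_of_weak_type {α : Type*} [MeasurableSpace α] {p : ℝ} (hp : 1 < p)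
    {μ : Measure α} {m : α → ℝ} (hm : Measurable m) (hm0 : ∀ x, 0 ≤ m x)
    {f : α → ℝ≥0∞} (hf : Measurable f)
    (hweak : ∀ c : ℝ, 0 < c →
      ENNReal.ofReal c * μ {x | c < m x} ≤ ∫⁻ x in {x | c < m x}, f x ∂μ)
    (hfin : ∫⁻ x, ENNReal.ofReal (m x ^ p) ∂μ ≠ ∞) :
    ∫⁻ x, ENNReal.ofReal (m x ^ p) ∂μ ≤
      ENNReal.ofReal ((p / (p - 1)) ^ p) * ∫⁻ x, f x ^ p ∂μ := by
  have hp0 : 0 < p := one_pos.trans hp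
  have hp1 : 0 < p - 1 := sub_pos.2 hp
  have hpq : p.HolderConjugate (p / (p - 1)) := Real.HolderConjugate.conjExponent hp
  set A := ∫⁻ x, ENNReal.ofReal (m x ^ p) ∂μ with hA
  rcases eq_or_ne A 0 with hA0 | hA0
  · rw [hA0]; exact zero_le
  have hlayer : A ≤ ENNReal.ofReal (p / (p - 1)) * ∫⁻ x, f x * ENNReal.ofReal (m x ^ (p - 1)) ∂μ := by
    have h1 := lintegral_rpow_eq_lintegral_meas_lt_mul μ (ae_of_all _ hm0) hm.aemeasurable hp0
    have h2 := lintegral_rpow_eq_lintegral_meas_lt_mul (μ.withDensity f) (ae_of_all _ hm0)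
      hm.aemeasurable hp1
    rw [lintegral_withDensity_eq_lintegral_mul _ hf (hm.pow_const _).ennreal_ofReal] at h2
    calc A = ENNReal.ofReal p *
          ∫⁻ t in Ioi 0, μ {x | t < m x} * ENNReal.ofReal (t ^ (p - 1)) := h1
      _ ≤ ENNReal.ofReal p * ∫⁻ t in Ioi 0,
          μ.withDensity f {x | t < m x} * ENNReal.ofReal (t ^ (p - 1 - 1)) := by
          gcongr ENNReal.ofReal p * ?_
          refine setLIntegral_mono' measurableSet_Ioi fun t ht => ?_
          have ht0 : (0 : ℝ) < t := ht
          rw [withDensity_apply _ (measurableSet_lt measurable_const hm)]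
          refine le_trans (le_of_eq ?_) (mul_le_mul_left (hweak t ht0) _)
          rw [mul_comm (ENNReal.ofReal t), mul_assoc, ← ENNReal.ofReal_mul ht0.le,
            mul_comm t, ← Real.rpow_add_one ht0.ne', sub_add_cancel]
      _ = ENNReal.ofReal (p / (p - 1)) * (ENNReal.ofReal (p - 1) * ∫⁻ t in Ioi 0,
          μ.withDensity f {x | t < m x} * ENNReal.ofReal (t ^ (p - 1 - 1))) := by
          rw [← mul_assoc, ← ENNReal.ofReal_mul (by positivity), div_mul_cancel₀ _ hp1.ne']
      _ = _ := by rw [← h2]; rfl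
  have hH := ENNReal.lintegral_mul_le_Lp_mul_Lq μ hpq hf.aemeasurable
    (g := fun x => ENNReal.ofReal (m x ^ (p - 1))) (hm.pow_const _).ennreal_ofReal.aemeasurable
  have hpow : ∀ x, ENNReal.ofReal (m x ^ (p - 1)) ^ (p / (p - 1)) = ENNReal.ofReal (m x ^ p) :=
    fun x => by
      rw [ENNReal.ofReal_rpow_of_nonneg (Real.rpow_nonneg (hm0 x) _) (by positivity),
        ← Real.rpow_mul (hm0 x), mul_div_cancel₀ _ hp1.ne']
  simp only [hpow, ← hA, Pi.mul_apply] at hH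
  have hmain : A ≤ ENNReal.ofReal (p / (p - 1)) *
      (∫⁻ x, f x ^ p ∂μ) ^ (1 / p) * A ^ (1 / (p / (p - 1))) := by
    rw [mul_assoc]
    exact hlayer.trans (by gcongr)
  have hdiv : A ^ (1 / p) ≤ ENNReal.ofReal (p / (p - 1)) * (∫⁻ x, f x ^ p ∂μ) ^ (1 / p) := by
    have h0 : A ^ (1 / (p / (p - 1))) ≠ 0 := by simp [ENNReal.rpow_eq_zero_iff, hA0, hfin]
    have h1 : A ^ (1 / (p / (p - 1))) ≠ ∞ := by simp [ENNReal.rpow_eq_top_iff, hA0, hfin]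
    rw [← ENNReal.mul_le_mul_iff_left h0 h1, ← ENNReal.rpow_add _ _ hA0 hfin]
    have e : 1 / p + 1 / (p / (p - 1)) = 1 := by field_simp; ring
    rwa [e, ENNReal.rpow_one]
  calc A = (A ^ (1 / p)) ^ p := by
        rw [← ENNReal.rpow_mul, one_div_mul_cancel hp0.ne', ENNReal.rpow_one]
    _ ≤ (ENNReal.ofReal (p / (p - 1)) * (∫⁻ x, f x ^ p ∂μ) ^ (1 / p)) ^ p := by gcongr
    _ = _ := by
        rw [ENNReal.mul_rpow_of_nonneg _ _ hp0.le, ← ENNReal.rpow_mul,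
          one_div_mul_cancel hp0.ne', ENNReal.rpow_one, ENNReal.ofReal_rpow_of_pos (by positivity)]

/-! ### Tomaselli's inequality for pairs of measures -/

/-- Superlevel sets of a decreasing function are lower sets, so the hypothesis compares them and
layer cake finishes. -/
theorem lintegral_rpow_le_of_measure_Iio_le {p : ℝ} (hp : 0 < p) {μ κ : Measure ℝ}
    [NullSingletonClass κ] {B : ℝ≥0∞} (hB : ∀ s, κ (Iio s) ≤ B * μ (Iio s))
    {m : ℝ → ℝ} (hm : Antitone m) (hm0 : ∀ x, 0 ≤ m x) :
    ∫⁻ x, ENNReal.ofReal (m x ^ p) ∂κ ≤ B * ∫⁻ x, ENNReal.ofReal (m x ^ p) ∂μ := by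
  have hlevel : ∀ t, κ {x | t < m x} ≤ B * μ {x | t < m x} := fun t =>
    (measure_le_iSup_Iio κ _).trans <| iSup₂_le fun s hs => (hB s).trans <| by
      gcongr
      intro x hx
      exact lt_of_lt_of_le hs (hm (le_of_lt hx))
  rw [lintegral_rpow_eq_lintegral_meas_lt_mul κ (ae_of_all _ hm0) hm.measurable.aemeasurable hp,
    lintegral_rpow_eq_lintegral_meas_lt_mul μ (ae_of_all _ hm0) hm.measurable.aemeasurable hp]
  have hmeas : Measurable fun t : ℝ => μ {x | t < m x} * ENNReal.ofReal (t ^ (p - 1)) := by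
    refine Measurable.mul (Antitone.measurable fun s t hst => measure_mono fun x hx => ?_)
      (measurable_id.pow_const _).ennreal_ofReal
    exact lt_of_le_of_lt hst hx
  calc _ ≤ ENNReal.ofReal p *
        ∫⁻ t in Ioi 0, B * (μ {x | t < m x} * ENNReal.ofReal (t ^ (p - 1))) := by
        simp only [← mul_assoc]
        gcongr with t
        exact hlevel t
    _ = _ := by
        rw [lintegral_const_mul _ hmeas]
        ring

/-- The least decreasing majorant of `U` on `(-∞, k]`, cut off at height `k` and extended by zero
to the right of `k`. -/
noncomputable def truncatedMajorant (U : ℝ → ℝ≥0∞) (k : ℕ) (t : ℝ) : ℝ≥0∞ :=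
  min (⨆ (s : ℝ) (_ : t ≤ s ∧ s ≤ k), U s) k

theorem truncatedMajorant_antitone (U : ℝ → ℝ≥0∞) (k : ℕ) : Antitone (truncatedMajorant U k) :=
  fun _ _ h => min_le_min_right _ <| iSup₂_le fun s hs =>
    le_iSup₂_of_le s ⟨h.trans hs.1, hs.2⟩ le_rfl

theorem truncatedMajorant_monotone (U : ℝ → ℝ≥0∞) (t : ℝ) :
    Monotone fun k => truncatedMajorant U k t := fun k l h => by
  refine min_le_min (iSup₂_le fun s hs => le_iSup₂_of_le s ⟨hs.1, hs.2.trans ?_⟩ le_rfl) ?_ <;>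
  exact_mod_cast h

theorem truncatedMajorant_ne_top (U : ℝ → ℝ≥0∞) (k : ℕ) (t : ℝ) : truncatedMajorant U k t ≠ ∞ :=
  ((min_le_right _ _).trans_lt (ENNReal.natCast_lt_top k)).ne

theorem truncatedMajorant_eq_zero {U : ℝ → ℝ≥0∞} {k : ℕ} {t : ℝ} (h : (k : ℝ) < t) :
    truncatedMajorant U k t = 0 := by
  have : (⨆ (s : ℝ) (_ : t ≤ s ∧ s ≤ k), U s) = 0 :=
    le_zero_iff.1 (iSup₂_le fun s hs => absurd (hs.1.trans hs.2) h.not_ge)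
  simp [truncatedMajorant, this]

theorem le_iSup_truncatedMajorant (U : ℝ → ℝ≥0∞) (t : ℝ) :
    U t ≤ ⨆ k, truncatedMajorant U k t := by
  refine le_of_forall_lt fun c hc => ?_
  obtain ⟨k, hk⟩ := ENNReal.exists_nat_gt hc.ne_top
  obtain ⟨l, hl⟩ := exists_nat_ge t
  refine lt_of_lt_of_le ?_ (le_iSup _ (max k l))
  refine lt_min (lt_of_lt_of_le hc (le_iSup₂_of_le t ⟨le_rfl, ?_⟩ le_rfl)) (hk.trans_le ?_)
  · exact hl.trans (by exact_mod_cast le_max_right _ _)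
  · exact_mod_cast le_max_left _ _

theorem exists_lt_of_lt_truncatedMajorant {U : ℝ → ℝ≥0∞} {k : ℕ} {t : ℝ} {c : ℝ≥0∞}
    (h : c < truncatedMajorant U k t) :
    ∃ s, t ≤ s ∧ c < U s ∧ ∀ x ≤ s, c < truncatedMajorant U k x := by
  obtain ⟨h1, h2⟩ := lt_min_iff.1 h
  simp only [lt_iSup_iff] at h1
  obtain ⟨s, hs, hcs⟩ := h1
  exact ⟨s, hs.1, hcs, fun x hx => lt_min (hcs.trans_le (le_iSup₂_of_le s ⟨hx, hs.2⟩ le_rfl)) h2⟩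

/-- If the majorant exceeds `c` at `s`, some average up to `s' ≥ s` exceeds `c`, and `Iio s'` stays
inside the level set: this is the weak-type bound. The cut-offs make the `p`-th moment finite. -/
theorem lintegral_truncatedMajorant_rpow_le {p : ℝ} (hp : 1 < p) {μ : Measure ℝ}
    [NullSingletonClass μ] (hμ : ∀ s, μ (Iio s) ≠ ∞) {f : ℝ → ℝ≥0∞} (hf : Measurable f) (k : ℕ) :
    ∫⁻ r, ENNReal.ofReal ((truncatedMajorant
        (fun s => (∫⁻ t in Iio s, f t ∂μ) / μ (Iio s)) k r).toReal ^ p) ∂μ ≤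
      ENNReal.ofReal ((p / (p - 1)) ^ p) * ∫⁻ t, f t ^ p ∂μ := by
  have hp0 : 0 < p := one_pos.trans hp
  set U : ℝ → ℝ≥0∞ := fun s => (∫⁻ t in Iio s, f t ∂μ) / μ (Iio s) with hU
  have hlt : ∀ (c r : ℝ), 0 ≤ c → (c < (truncatedMajorant U k r).toReal ↔
      ENNReal.ofReal c < truncatedMajorant U k r) := fun c r hc =>
    (ENNReal.ofReal_lt_iff_lt_toReal hc (truncatedMajorant_ne_top U k r)).symm
  refine lintegral_rpow_le_of_weak_type hp
    (truncatedMajorant_antitone U k).measurable.ennreal_toReal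
    (fun _ => ENNReal.toReal_nonneg) hf (fun c hc => ?_) ?_
  · have hset : {x | c < (truncatedMajorant U k x).toReal} =
        {x | ENNReal.ofReal c < truncatedMajorant U k x} := by
      ext x; exact hlt c x hc.le
    rw [hset]
    grw [measure_le_iSup_Iio μ {x | ENNReal.ofReal c < truncatedMajorant U k x}]
    simp only [ENNReal.mul_iSup]
    refine iSup₂_le fun s hs => ?_
    obtain ⟨s', hss', hcs', hx⟩ := exists_lt_of_lt_truncatedMajorant hs
    calc ENNReal.ofReal c * μ (Iio s) ≤ ENNReal.ofReal c * μ (Iio s') := by gcongr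
      _ ≤ ∫⁻ t in Iio s', f t ∂μ := ENNReal.mul_le_of_le_div hcs'.le
      _ ≤ _ := lintegral_mono_set fun x hxs => hx x (le_of_lt hxs)
  · have hbound : ∀ r, ENNReal.ofReal ((truncatedMajorant U k r).toReal ^ p) ≤
        (Iio ((k : ℝ) + 1)).indicator (fun _ => ENNReal.ofReal ((k : ℝ) ^ p)) r := fun r => by
      rcases lt_or_ge (k : ℝ) r with h | h
      · rw [truncatedMajorant_eq_zero h]
        simp [Real.zero_rpow hp0.ne']
      · rw [indicator_of_mem (show r ∈ Iio ((k : ℝ) + 1) from by rw [mem_Iio]; linarith)]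
        gcongr
        exact ENNReal.toReal_le_of_le_ofReal (by positivity)
          ((min_le_right _ _).trans (by simp))
    refine ((lintegral_mono hbound).trans_lt ?_).ne
    rw [lintegral_indicator measurableSet_Iio, setLIntegral_const]
    exact ENNReal.mul_lt_top ENNReal.ofReal_lt_top (hμ _).lt_top

theorem lintegral_hardy_le_of_average_bound {p : ℝ} (hp : 1 < p) {μ ν : Measure ℝ}
    [NullSingletonClass μ] [NullSingletonClass ν] (hμ : ∀ s, μ (Iio s) ≠ ∞)
    {f : ℝ → ℝ≥0∞} (hf : Measurable f) {B : ℝ≥0∞}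
    (hB : ∀ s, ∫⁻ t in Iio s, μ (Iio t) ^ p ∂ν ≤ B * μ (Iio s)) :
    ∫⁻ r, (∫⁻ t in Iio r, f t ∂μ) ^ p ∂ν ≤
      ENNReal.ofReal ((p / (p - 1)) ^ p) * B * ∫⁻ t, f t ^ p ∂μ := by
  have hp0 : 0 < p := one_pos.trans hp
  have hφ : Measurable fun t => μ (Iio t) ^ p := (measurable_measure_Iio μ).pow_const _
  set U : ℝ → ℝ≥0∞ := fun s => (∫⁻ t in Iio s, f t ∂μ) / μ (Iio s) with hU
  have hM : ∀ k, Measurable fun r => truncatedMajorant U k r ^ p := fun k =>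
    (truncatedMajorant_antitone U k).measurable.pow_const _
  have hT : ∀ r, ∫⁻ t in Iio r, f t ∂μ = μ (Iio r) * U r := fun r => by
    rcases eq_or_ne (μ (Iio r)) 0 with h | h
    · rw [h, zero_mul, Measure.restrict_eq_zero.2 h, lintegral_zero_measure]
    · rw [hU, ENNReal.mul_div_cancel h (hμ r)]
  have hk : ∀ k, ∫⁻ r, μ (Iio r) ^ p * truncatedMajorant U k r ^ p ∂ν ≤
      ENNReal.ofReal ((p / (p - 1)) ^ p) * B * ∫⁻ t, f t ^ p ∂μ := fun k => by
    have hreal : ∀ r, truncatedMajorant U k r ^ p =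
        ENNReal.ofReal ((truncatedMajorant U k r).toReal ^ p) := fun r => by
      rw [← ENNReal.ofReal_rpow_of_nonneg ENNReal.toReal_nonneg hp0.le,
        ENNReal.ofReal_toReal (truncatedMajorant_ne_top U k r)]
    have hcomp := lintegral_rpow_le_of_measure_Iio_le hp0 (μ := μ)
      (κ := ν.withDensity fun t => μ (Iio t) ^ p) (B := B)
      (fun s => by rw [withDensity_apply _ measurableSet_Iio]; exact hB s)
      (m := fun r => (truncatedMajorant U k r).toReal)
      (fun s t h => ENNReal.toReal_mono (truncatedMajorant_ne_top U k s)
        (truncatedMajorant_antitone U k h)) (fun _ => ENNReal.toReal_nonneg)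
    have hmax := lintegral_truncatedMajorant_rpow_le hp hμ hf k
    simp only [← hU, ← hreal] at hcomp hmax
    rw [lintegral_withDensity_eq_lintegral_mul _ hφ (hM k)] at hcomp
    calc _ ≤ B * ∫⁻ r, truncatedMajorant U k r ^ p ∂μ := hcomp
      _ ≤ B * (ENNReal.ofReal ((p / (p - 1)) ^ p) * ∫⁻ t, f t ^ p ∂μ) := by gcongr
      _ = _ := by ring
  -- Monotone convergence removes the truncation.
  calc _ ≤ ∫⁻ r, ⨆ k, μ (Iio r) ^ p * truncatedMajorant U k r ^ p ∂ν := by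
        refine lintegral_mono fun r => ?_
        rw [hT, ENNReal.mul_rpow_of_nonneg _ _ hp0.le, ← ENNReal.mul_iSup]
        gcongr
        refine (ENNReal.rpow_le_rpow (le_iSup_truncatedMajorant U r) hp0.le).trans ?_
        exact ((ENNReal.orderIsoRpow p hp0).map_iSup _).le
    _ = ⨆ k, ∫⁻ r, μ (Iio r) ^ p * truncatedMajorant U k r ^ p ∂ν := by
        refine lintegral_iSup (fun k => hφ.mul (hM k)) fun k l h r => ?_
        dsimp only
        gcongr
        exact truncatedMajorant_monotone U r h
    _ ≤ _ := iSup_le hk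

/-! ### Weights on the half-line as measures -/

theorem restrict_Ioi_restrict_Iio (a b : ℝ) :
    (volume.restrict (Ioi a)).restrict (Iio b) = volume.restrict (Ioo a b) := by
  rw [Measure.restrict_restrict measurableSet_Iio, inter_comm, Ioi_inter_Iio]

theorem ae_restrict_Ioi_zero_of_forall_Ioo {P : ℝ → Prop}
    (h : ∀ s : ℝ, 0 < s → ∀ᵐ t ∂volume.restrict (Ioo 0 s), P t) :
    ∀ᵐ t ∂volume.restrict (Ioi (0 : ℝ)), P t := by
  have hU : Ioi (0 : ℝ) = ⋃ n : ℕ, Ioo 0 ((n : ℝ) + 1) := by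
    ext t
    simp only [mem_Ioi, mem_iUnion, mem_Ioo, exists_and_left, iff_self_and]
    intro _
    obtain ⟨n, hn⟩ := exists_nat_gt t
    exact ⟨n, by linarith⟩
  rw [hU, ae_restrict_iUnion_iff]
  exact fun n => h _ (by positivity)

theorem rpow_neg_mul_div_rpow {p : ℝ} (hp : 1 < p) {a : ℝ≥0∞} (ha0 : a ≠ 0) (ha : a ≠ ∞)
    (b : ℝ≥0∞) :
    a ^ (-(1 / (p - 1))) * (b / a ^ (-(1 / (p - 1)))) ^ p = a * b ^ p := by
  have hp0 : 0 < p := one_pos.trans hp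
  have hp1 : 0 < p - 1 := sub_pos.2 hp
  rw [div_eq_mul_inv b, ENNReal.mul_rpow_of_nonneg _ _ hp0.le, ← ENNReal.rpow_neg,
    ← ENNReal.rpow_mul, mul_left_comm, ← ENNReal.rpow_add _ _ ha0 ha, mul_comm]
  have e : -(1 / (p - 1)) + - -(1 / (p - 1)) * p = 1 := by field_simp; ring
  rw [e, ENNReal.rpow_one]

theorem theorem3 {𝕜 : Type*} [RCLike 𝕜] (p : ℝ) (hp : 1 < p) (V W : ℝ → ℝ≥0∞)
    (hV : AEMeasurable V (volume.restrict (Ioi 0)))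
    (hW : AEMeasurable W (volume.restrict (Ioi 0)))
    (hVfin : ∀ᵐ r ∂(volume.restrict (Ioi (0 : ℝ))), V r ≠ ∞)
    (hWfin : ∀ᵐ r ∂(volume.restrict (Ioi (0 : ℝ))), W r ≠ ∞)
    (hVint : ∀ s : ℝ, 0 < s → ∫⁻ t in Ioo 0 s, V t ^ (-(1 / (p - 1))) < ∞)
    (u : ℝ → 𝕜) (hu : LocallyACOnPos u)
    (hu0 : liminf (fun r : ℝ => ‖u r‖ₑ) (𝓝[>] 0) = 0) :
    (∫⁻ r in Ioi (0 : ℝ), W r * ‖u r‖ₑ ^ p ≤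
      ENNReal.ofReal (p ^ p / (p - 1) ^ (p - 1)) * hardyBUpper p V W *
        ∫⁻ r in Ioi (0 : ℝ), V r * ‖deriv u r‖ₑ ^ p) ∧
    (∫⁻ r in Ioi (0 : ℝ), W r * ‖u r‖ₑ ^ p ≤
      ENNReal.ofReal ((p / (p - 1)) ^ p) * hardyBLower p V W *
        ∫⁻ r in Ioi (0 : ℝ), V r * ‖deriv u r‖ₑ ^ p) := by
  have hp0 : 0 < p := one_pos.trans hp
  have hp1 : 0 < p - 1 := sub_pos.2 hp
  have hvm : AEMeasurable (fun t => V t ^ (-(1 / (p - 1)))) (volume.restrict (Ioi 0)) :=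
    hV.pow_const _
  obtain ⟨v, hv, hVv⟩ := hvm
  obtain ⟨w, hw, hWw⟩ := hW
  set μ := (volume.restrict (Ioi (0 : ℝ))).withDensity v with hμdef
  set ν := (volume.restrict (Ioi (0 : ℝ))).withDensity w with hνdef
  have hφ : ∀ s, μ (Iio s) = hardyPhi p V s := fun s => by
    rw [hμdef, withDensity_apply _ measurableSet_Iio, ← lintegral_congr_ae (ae_restrict_of_ae hVv),
      restrict_Ioi_restrict_Iio, hardyPhi]
  have hφ_nonpos : ∀ s ≤ 0, hardyPhi p V s = 0 := fun s hs => by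
    rw [hardyPhi, Ioo_eq_empty hs.not_gt, setLIntegral_empty]
  have hμ : ∀ s, μ (Iio s) ≠ ∞ := fun s => by
    rw [hφ]
    rcases le_or_gt s 0 with hs | hs
    · simp [hφ_nonpos s hs]
    · exact (hVint s hs).ne
  -- Where `V = 0` the integrand of `hVint` is infinite.
  have hV0 : ∀ᵐ t ∂volume.restrict (Ioi (0 : ℝ)), V t ≠ 0 := by
    refine ae_restrict_Ioi_zero_of_forall_Ioo fun s hs => ?_
    have hm : AEMeasurable V (volume.restrict (Ioo 0 s)) := hV.mono_set Ioo_subset_Ioi_self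
    filter_upwards [ae_lt_top' (hm.pow_const _) (hVint s hs).ne] with t ht h0
    rw [h0, ENNReal.zero_rpow_of_neg (by simpa using hp)] at ht
    exact lt_irrefl _ ht
  have hg : Measurable fun t => ‖deriv u t‖ₑ := (measurable_deriv u).enorm
  set f : ℝ → ℝ≥0∞ := fun t => ‖deriv u t‖ₑ / v t with hfdef
  have hf : Measurable f := hg.div hv
  have hT : ∀ r, ∫⁻ t in Iio r, f t ∂μ = ∫⁻ t in Ioo 0 r, ‖deriv u t‖ₑ := fun r => by
    rw [hμdef, setLIntegral_withDensity_eq_setLIntegral_mul _ hv hf measurableSet_Iio,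
      ← restrict_Ioi_restrict_Iio]
    refine lintegral_congr_ae (ae_restrict_of_ae ?_)
    filter_upwards [hVv, hV0, hVfin] with t ht h0 hfin
    rw [Pi.mul_apply, hfdef, ENNReal.mul_div_cancel]
    · simp [← ht, ENNReal.rpow_eq_zero_iff, h0, hfin]
    · simp [← ht, ENNReal.rpow_eq_top_iff, h0, hfin]
  have hnorm : ∫⁻ t, f t ^ p ∂μ = ∫⁻ r in Ioi (0 : ℝ), V r * ‖deriv u r‖ₑ ^ p := by
    rw [hμdef, lintegral_withDensity_eq_lintegral_mul _ hv (hf.pow_const _)]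
    refine lintegral_congr_ae ?_
    filter_upwards [hVv, hV0, hVfin] with t ht h0 hfin
    simp only [Pi.mul_apply, hfdef, ← ht]
    exact rpow_neg_mul_div_rpow hp h0 hfin _
  have hTmeas : Measurable fun r => ∫⁻ t in Iio r, f t ∂μ :=
    Monotone.measurable fun _ _ h => lintegral_mono_set (Iio_subset_Iio h)
  have hleft : ∫⁻ r in Ioi (0 : ℝ), W r * ‖u r‖ₑ ^ p ≤
      ∫⁻ r, (∫⁻ t in Iio r, f t ∂μ) ^ p ∂ν := by
    rw [hνdef, lintegral_withDensity_eq_lintegral_mul _ hw (hTmeas.pow_const _)]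
    refine lintegral_mono_ae ?_
    filter_upwards [hWw, ae_restrict_mem measurableSet_Ioi] with r hr hr0
    rw [Pi.mul_apply, hr, hT]
    gcongr
    exact hu.enorm_le_lintegral hu0 hr0
  rw [← hnorm]
  refine ⟨hleft.trans (lintegral_hardy_le_of_tail_bound hp hμ hf fun s => ?_),
    hleft.trans (lintegral_hardy_le_of_average_bound hp hμ hf fun s => ?_)⟩
  · rw [hφ]
    rcases le_or_gt s 0 with hs | hs
    · rw [hφ_nonpos s hs, ENNReal.zero_rpow_of_pos hp1, zero_mul]
      exact zero_le
    · have hνs : ν (Ioi s) = ∫⁻ t in Ioi s, W t := by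
        rw [hνdef, withDensity_apply _ measurableSet_Ioi,
          ← lintegral_congr_ae (ae_restrict_of_ae hWw),
          Measure.restrict_restrict_of_subset (Ioi_subset_Ioi hs.le)]
      rw [hνs]
      exact le_iSup₂ (f := fun (s : ℝ) (_ : 0 < s) =>
        hardyPhi p V s ^ (p - 1) * ∫⁻ t in Ioi s, W t) s hs
  -- If `φ(s) = 0` its inverse is infinite and the supremum cannot be used, but the integrand
  -- vanishes.
  · rcases eq_or_ne (μ (Iio s)) 0 with h0 | h0
    · have hzero : ∫⁻ t in Iio s, μ (Iio t) ^ p ∂ν = 0 := by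
        rw [setLIntegral_congr_fun measurableSet_Iio (g := fun _ => 0), lintegral_zero]
        intro t ht
        have : μ (Iio t) = 0 := measure_mono_null (Iio_subset_Iio (le_of_lt ht)) h0
        simp [this, hp0]
      rw [hzero]
      exact zero_le
    · have hs : 0 < s := by
        by_contra hs
        exact h0 (by rw [hφ, hφ_nonpos s (not_lt.1 hs)])
      have hνs : ∫⁻ t in Iio s, μ (Iio t) ^ p ∂ν =
          ∫⁻ t in Ioo 0 s, W t * hardyPhi p V t ^ p := by
        rw [hνdef, setLIntegral_withDensity_eq_setLIntegral_mul _ hw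
          ((measurable_measure_Iio μ).pow_const _) measurableSet_Iio, ← restrict_Ioi_restrict_Iio]
        refine lintegral_congr_ae (ae_restrict_of_ae ?_)
        filter_upwards [hWw] with t ht
        rw [Pi.mul_apply, ht, hφ]
      rw [hνs, mul_comm, ← ENNReal.inv_mul_le_iff h0 (hμ s), hφ]
      exact le_iSup₂ (f := fun (s : ℝ) (_ : 0 < s) =>
        (hardyPhi p V s)⁻¹ * ∫⁻ t in Ioo 0 s, W t * hardyPhi p V t ^ p) s hs
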